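/- Let $A$ be a commutative ring with unit (possibly the zero ring). Let $\mathbb{T}$ be the propositional geometric theory of prime filters of $A$: it has one nullary relation symbol $D(x)$ for each $x \in A$ and the axioms $$D(0) \vdash \bot,\quad D(x+y) \vdash D(x) \vee D(y),\quad D(xy) \vdash D(x),\quad \top \vdash D(1),\quad D(x) \wedge D(y) \vdash D(xy) \qquad (x, y \in A).$$ Let $\mathrm{Spec}(A)$ be the classifying locale of $\mathbb{T}$, that is, the locale whose frame of opens is the Lindenbaum algebra of $\mathbb{T}$: the geometric formulas over the symbols $D(x)$ (built with $\top$, $\wedge$, $\bot$, $\vee$ and set-indexed $\bigvee$) modulo $\mathbb{T}$-provable equivalence, ordered by $[\varphi] \preceq [\psi]$ iff $\mathbb{T}$ proves $\varphi \vdash \psi$ in geometric logic. Let $\underline{A}$ be the constant sheaf of rings on $\mathrm{Spec}(A)$ associated to $A$, and let the generic prime filter $\mathfrak{f}_0 \subseteq \underline{A}$ be the subsheaf of those sections $g$ such that $g^{-1}[\{x\}] \preceq [D(x)]$ for all $x \in A$, where $g^{-1}[\{x\}]$ denotes the largest open on which $g$ is constantly $x$. Let $A^\sim := \underline{A}[\mathfrak{f}_0^{-1}]$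 be the localization of $\underline{A}$ at $\mathfrak{f}_0$, that is, the sheaf of rings on $\mathrm{Spec}(A)$ associated to the presheaf $U \mapsto \underline{A}(U)[\mathfrak{f}_0(U)^{-1}]$. For every open $U$ there is a canonical ring homomorphism $A \to \underline{A}(U) \to A^\sim(U)$, given by constant sections followed by the localization morphism. For every $f \in A$ there is a canonical isomorphism of rings $$A[f^{-1}] \longrightarrow A^\sim([D(f)]),$$ namely a unique ring isomorphism which is compatible with the canonical homomorphisms $A \to A[f^{-1}]$ and $A \to A^\sim([D(f)])$. In particular (for $f = 1$), the canonical homomorphism $A \to A^\sim(\mathrm{Spec}(A))$ is an isomorphism of rings. -/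

import Mathlib

open CategoryTheory Opposite

universe u v w

namespace LocalicSpec

/-! ## Propositional geometric logic -/

/-- Geometric formulas over a set `S` of nullary relation symbols (no sorts). Disjunctions are
indexed by arbitrary (small) sets. -/
inductive GeoFormula (S : Type u) : Type (u + 1)
  | sym (s : S) : GeoFormula S
  | top : GeoFormula S
  | and (φ ψ : GeoFormula S) : GeoFormula S
  | bot : GeoFormula S
  | or (φ ψ : GeoFormula S) : GeoFormula S
  | disj {I : Type u} (φ : I → GeoFormula S) : GeoFormula S

/-- A propositional geometric theory over the nullary relation symbols `S`: a collection of axioms,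
where `T.IsAxiom φ ψ` says that the sequent `φ ⊢ ψ` is an axiom. -/
structure GeoTheory (S : Type u) where
  IsAxiom : GeoFormula S → GeoFormula S → Prop

/-- `Provable T φ ψ`: the theory `T` proves the sequent `φ ⊢ ψ` in (propositional) geometric
logic. -/
inductive Provable {S : Type u} (T : GeoTheory S) : GeoFormula S → GeoFormula S → Prop
  | ax {φ ψ : GeoFormula S} (h : T.IsAxiom φ ψ) : Provable T φ ψ
  | refl (φ : GeoFormula S) : Provable T φ φ
  | cut {φ ψ χ : GeoFormula S} (h : Provable T φ ψ) (k : Provable T ψ χ) : Provable T φ χ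
  | top_intro (φ : GeoFormula S) : Provable T φ .top
  | and_left (φ ψ : GeoFormula S) : Provable T (.and φ ψ) φ
  | and_right (φ ψ : GeoFormula S) : Provable T (.and φ ψ) ψ
  | and_intro {φ ψ χ : GeoFormula S} (h : Provable T φ ψ) (k : Provable T φ χ) :
      Provable T φ (.and ψ χ)
  | bot_elim (φ : GeoFormula S) : Provable T .bot φ
  | or_left (φ ψ : GeoFormula S) : Provable T φ (.or φ ψ)
  | or_right (φ ψ : GeoFormula S) : Provable T ψ (.or φ ψ)
  | or_elim {φ ψ χ : GeoFormula S} (h : Provable T φ χ) (k : Provable T ψ χ) :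
      Provable T (.or φ ψ) χ
  | disj_intro {I : Type u} (φ : I → GeoFormula S) (i : I) : Provable T (φ i) (.disj φ)
  | disj_elim {I : Type u} {φ : I → GeoFormula S} {χ : GeoFormula S}
      (h : ∀ i, Provable T (φ i) χ) : Provable T (.disj φ) χ
  | distrib {I : Type u} (φ : I → GeoFormula S) (ψ : GeoFormula S) :
      Provable T (.and (.disj φ) ψ) (.disj fun i => .and (φ i) ψ)

/-! ## The Lindenbaum algebra -/

section Lindenbaum

variable {S : Type u} (T : GeoTheory S)

/-- Provable equivalence of geometric formulas. -/
def provableSetoid : Setoid (GeoFormula S) where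
  r φ ψ := Provable T φ ψ ∧ Provable T ψ φ
  iseqv :=
    ⟨fun φ => ⟨.refl φ, .refl φ⟩, fun h => ⟨h.2, h.1⟩, fun h k => ⟨h.1.cut k.1, k.2.cut h.2⟩⟩

/-- The Lindenbaum algebra of `T`: geometric formulas modulo provable equivalence. It is the
frame of opens of the classifying locale of `T`. -/
def Lindenbaum : Type (u + 1) := Quotient (provableSetoid T)

/-- The class `[φ]` of a formula in the Lindenbaum algebra. -/
def cls (φ : GeoFormula S) : Lindenbaum T := Quotient.mk (provableSetoid T) φ

instance : PartialOrder (Lindenbaum T) where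
  le := Quotient.lift₂ (fun φ ψ => Provable T φ ψ) fun _ _ _ _ h k =>
    propext ⟨fun p => h.2.cut (p.cut k.1), fun p => h.1.cut (p.cut k.2)⟩
  le_refl := by rintro ⟨φ⟩; exact .refl φ
  le_trans := by rintro ⟨φ⟩ ⟨ψ⟩ ⟨χ⟩ h k; exact Provable.cut h k
  le_antisymm := by rintro ⟨φ⟩ ⟨ψ⟩ h k; exact Quotient.sound ⟨h, k⟩

variable {T}

theorem cls_le_cls {φ ψ : GeoFormula S} : cls T φ ≤ cls T ψ ↔ Provable T φ ψ := Iff.rfl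

theorem exists_cls (x : Lindenbaum T) : ∃ φ, cls T φ = x := Quotient.exists_rep x

/-- The conjunction of a finite list of symbols. -/
def conj : List S → GeoFormula S
  | [] => .top
  | a :: l => .and (.sym a) (conj l)

theorem conj_append (l m : List S) : Provable T (.and (conj l) (conj m)) (conj (l ++ m)) := by
  induction l with
  | nil => exact .and_right _ _
  | cons a l ih =>
    exact .and_intro ((Provable.and_left _ _).cut (.and_left _ _))
      (Provable.cut (.and_intro ((Provable.and_left _ _).cut (.and_right _ _)) (.and_right _ _)) ih)

theorem conj_append_left (l m : List S) : Provable T (conj (l ++ m)) (conj l) := by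
  induction l with
  | nil => exact .top_intro _
  | cons a l ih => exact .and_intro (.and_left _ _) ((Provable.and_right _ _).cut ih)

theorem conj_append_right (l m : List S) : Provable T (conj (l ++ m)) (conj m) := by
  induction l with
  | nil => exact .refl _
  | cons a l ih => exact (Provable.and_right _ _).cut ih

/-- Every geometric formula is provably covered by the finite conjunctions of symbols below it. -/
theorem normal_form (φ : GeoFormula S) :
    Provable T φ (.disj fun l : {l : List S // Provable T (conj l) φ} => conj l.1) := by
  have mono : ∀ {φ ψ : GeoFormula S}, Provable T φ ψ →
      Provable T (.disj fun l : {l : List S // Provable T (conj l) φ} => conj l.1)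
        (.disj fun l : {l : List S // Provable T (conj l) ψ} => conj l.1) := fun h =>
    .disj_elim fun l => .disj_intro (fun l : {l : List S // Provable T (conj l) _} => conj l.1)
      ⟨l.1, l.2.cut h⟩
  induction φ with
  | sym s =>
    exact Provable.cut (.and_intro (.refl _) (.top_intro _))
      (.disj_intro (fun l : {l : List S // Provable T (conj l) (.sym s)} => conj l.1)
        ⟨[s], .and_left _ _⟩)
  | top =>
    exact .disj_intro (fun l : {l : List S // Provable T (conj l) .top} => conj l.1)
      ⟨[], .refl _⟩
  | bot => exact .bot_elim _
  | or φ ψ hφ hψ =>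
    exact .or_elim (hφ.cut (mono (.or_left _ _))) (hψ.cut (mono (.or_right _ _)))
  | disj φ ih => exact .disj_elim fun i => (ih i).cut (mono (.disj_intro φ i))
  | and φ ψ hφ hψ =>
    refine Provable.cut (.and_intro ((Provable.and_left _ _).cut hφ) (.and_right _ _)) ?_
    refine (Provable.distrib _ _).cut (.disj_elim fun l => ?_)
    refine Provable.cut
      (.and_intro ((Provable.and_right _ _).cut hψ) (.and_left _ _)) ?_
    refine (Provable.distrib _ _).cut (.disj_elim fun m => ?_)
    exact (conj_append m.1 l.1).cut
      (.disj_intro (fun l : {l : List S // Provable T (conj l) (.and φ ψ)} => conj l.1)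
        ⟨m.1 ++ l.1, .and_intro ((conj_append_right _ _).cut l.2)
          ((conj_append_left _ _).cut m.2)⟩)

/-- A formula representing the join of an arbitrary subset of the Lindenbaum algebra. -/
def joinFormula (s : Set (Lindenbaum T)) : GeoFormula S :=
  .disj fun l : {l : List S // ∃ x ∈ s, cls T (conj l) ≤ x} => conj l.1

theorem isLUB_joinFormula (s : Set (Lindenbaum T)) : IsLUB s (cls T (joinFormula s)) := by
  constructor
  · intro x hx
    obtain ⟨φ, rfl⟩ := exists_cls x
    exact (normal_form φ).cut (.disj_elim fun l =>
      .disj_intro (fun l : {l : List S // ∃ x ∈ s, cls T (conj l) ≤ x} => conj l.1)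
        ⟨l.1, _, hx, l.2⟩)
  · intro b hb
    obtain ⟨ψ, rfl⟩ := exists_cls b
    refine cls_le_cls.2 (.disj_elim fun l => ?_)
    obtain ⟨x, hx, hl⟩ := l.2
    exact hl.trans (hb hx)

noncomputable instance : CompleteLattice (Lindenbaum T) where
  sup := Quotient.map₂ .or fun _ _ h _ _ k =>
    ⟨.or_elim (h.1.cut (.or_left _ _)) (k.1.cut (.or_right _ _)),
      .or_elim (h.2.cut (.or_left _ _)) (k.2.cut (.or_right _ _))⟩
  le_sup_left := by rintro ⟨φ⟩ ⟨ψ⟩; exact .or_left φ ψ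
  le_sup_right := by rintro ⟨φ⟩ ⟨ψ⟩; exact .or_right φ ψ
  sup_le := by rintro ⟨φ⟩ ⟨ψ⟩ ⟨χ⟩ h k; exact Provable.or_elim h k
  inf := Quotient.map₂ .and fun _ _ h _ _ k =>
    ⟨.and_intro ((Provable.and_left _ _).cut h.1) ((Provable.and_right _ _).cut k.1),
      .and_intro ((Provable.and_left _ _).cut h.2) ((Provable.and_right _ _).cut k.2)⟩
  inf_le_left := by rintro ⟨φ⟩ ⟨ψ⟩; exact .and_left φ ψ
  inf_le_right := by rintro ⟨φ⟩ ⟨ψ⟩; exact .and_right φ ψ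
  le_inf := by rintro ⟨φ⟩ ⟨ψ⟩ ⟨χ⟩ h k; exact Provable.and_intro h k
  top := cls T .top
  le_top := by rintro ⟨φ⟩; exact .top_intro φ
  bot := cls T .bot
  bot_le := by rintro ⟨φ⟩; exact .bot_elim φ
  sSup s := cls T (joinFormula s)
  isLUB_sSup s := isLUB_joinFormula s
  sInf s := cls T (joinFormula (lowerBounds s))
  isGLB_sInf s := isLUB_lowerBounds.1 (isLUB_joinFormula (lowerBounds s))

theorem cls_top : cls T .top = ⊤ := rfl

theorem cls_bot : cls T .bot = ⊥ := rfl

theorem cls_and (φ ψ : GeoFormula S) : cls T (.and φ ψ) = cls T φ ⊓ cls T ψ := rfl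

theorem cls_or (φ ψ : GeoFormula S) : cls T (.or φ ψ) = cls T φ ⊔ cls T ψ := rfl

theorem cls_disj {I : Type u} (φ : I → GeoFormula S) : cls T (.disj φ) = ⨆ i, cls T (φ i) := by
  apply le_antisymm
  · obtain ⟨ψ, hψ⟩ := exists_cls (⨆ i, cls T (φ i))
    rw [← hψ]
    exact cls_le_cls.2 (.disj_elim fun i => cls_le_cls.1 (hψ ▸ le_iSup (fun i => cls T (φ i)) i))
  · exact iSup_le fun i => cls_le_cls.2 (.disj_intro φ i)

/-- The Lindenbaum algebra is a frame. -/
noncomputable instance : Order.Frame (Lindenbaum T) :=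
  .ofMinimalAxioms
    { inf_sSup_le_iSup_inf := by
        intro a s
        obtain ⟨α, rfl⟩ := exists_cls a
        have h : cls T α ⊓ sSup s = sSup s ⊓ cls T α := inf_comm _ _
        rw [h]
        change cls T (.and (joinFormula s) α) ≤ _
        refine (cls_le_cls.2 (.distrib _ _)).trans ?_
        rw [cls_disj]
        refine iSup_le fun l => ?_
        obtain ⟨x, hx, hl⟩ := l.2
        refine le_trans ?_ (le_iSup₂ x hx)
        rw [cls_and, inf_comm]
        exact inf_le_inf_left _ hl }

end Lindenbaum

/-! ## Models in frames and the generic model -/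

/-- The interpretation of a geometric formula in a frame, given opens for the symbols. -/
def GeoFormula.eval {S : Type u} {X : Type v} [Order.Frame X] (U : S → X) : GeoFormula S → X
  | .sym s => U s
  | .top => ⊤
  | .and φ ψ => φ.eval U ⊓ ψ.eval U
  | .bot => ⊥
  | .or φ ψ => φ.eval U ⊔ ψ.eval U
  | .disj φ => ⨆ i, (φ i).eval U

/-- A sheaf model of a propositional geometric theory over the locale with frame of opens `X`: a
family of opens, one for each nullary relation symbol, satisfying the axioms. -/
structure SheafModel {S : Type u} (T : GeoTheory S) (X : Type v) [Order.Frame X] where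
  opens : S → X
  valid : ∀ φ ψ : GeoFormula S, T.IsAxiom φ ψ → φ.eval opens ≤ ψ.eval opens

theorem eval_cls {S : Type u} (T : GeoTheory S) (φ : GeoFormula S) :
    φ.eval (fun s => cls T (.sym s)) = cls T φ := by
  induction φ with
  | sym s => rfl
  | top => rfl
  | bot => rfl
  | and φ ψ hφ hψ => rw [GeoFormula.eval, hφ, hψ, cls_and]
  | or φ ψ hφ hψ => rw [GeoFormula.eval, hφ, hψ, cls_or]
  | disj φ ih => rw [GeoFormula.eval, cls_disj]; exact iSup_congr ih

/-- The generic model of `T`, over its classifying locale: the symbol `s` is interpreted by the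
open `[s]`. -/
def genericModel {S : Type u} (T : GeoTheory S) : SheafModel T (Lindenbaum T) where
  opens s := cls T (.sym s)
  valid φ ψ h := by
    rw [eval_cls, eval_cls]
    exact cls_le_cls.2 (.ax h)

/-! ## The localic spectrum -/

/-- The axioms of the theory of prime filters of `A`; the symbol `D(x)` is `.sym x`. -/
inductive PrimeFilterAxiom (A : Type u) [CommRing A] : GeoFormula A → GeoFormula A → Prop
  | zero : PrimeFilterAxiom A (.sym 0) .bot
  | add (x y : A) : PrimeFilterAxiom A (.sym (x + y)) (.or (.sym x) (.sym y))
  | mul_left (x y : A) : PrimeFilterAxiom A (.sym (x * y)) (.sym x)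
  | one : PrimeFilterAxiom A .top (.sym 1)
  | mul (x y : A) : PrimeFilterAxiom A (.and (.sym x) (.sym y)) (.sym (x * y))

/-- The propositional geometric theory of prime filters of `A`. -/
def primeFilterTheory (A : Type u) [CommRing A] : GeoTheory A where
  IsAxiom := PrimeFilterAxiom A

/-- The frame of opens of the localic spectrum `Spec(A)`, the classifying locale of the theory of
prime filters of `A`. -/
abbrev SpecOpens (A : Type u) [CommRing A] : Type (u + 1) := Lindenbaum (primeFilterTheory A)

/-- The generic prime filter of `A`, as a family of opens of `Spec(A)`. -/
def genericPrimeFilterModel (A : Type u) [CommRing A] :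
    SheafModel (primeFilterTheory A) (SpecOpens A) :=
  genericModel (primeFilterTheory A)

/-- The open `[D(f)]` of `Spec(A)`. -/
def basicOpen {A : Type u} [CommRing A] (f : A) : SpecOpens A :=
  (genericPrimeFilterModel A).opens f

theorem basicOpen_one {A : Type u} [CommRing A] : (basicOpen (1 : A)) = ⊤ :=
  top_le_iff.1 ((genericPrimeFilterModel A).valid _ _ PrimeFilterAxiom.one)

theorem basicOpen_inf_le {A : Type u} [CommRing A] (f g : A) :
    basicOpen f ⊓ basicOpen g ≤ basicOpen (f * g) :=
  (genericPrimeFilterModel A).valid _ _ (PrimeFilterAxiom.mul f g)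

/-! ## Sheaves of rings on a locale -/

/-- The Grothendieck topology on the frame of opens `X` of a locale: a sieve on `U` covers if and
only if the join of its members is `U`. -/
def localeTopology (X : Type v) [Order.Frame X] : GrothendieckTopology X where
  sieves U := {R | sSup {V : X | ∃ i : V ⟶ U, R i} = U}
  top_mem' U := (le_antisymm (sSup_le fun _ h => h.choose.le) (le_sSup ⟨𝟙 U, trivial⟩))
  pullback_stable' U V R i hR := by
    refine le_antisymm (sSup_le fun _ h => h.choose.le) ?_
    have h : V ≤ V ⊓ sSup {W : X | ∃ i : W ⟶ U, R i} := le_inf le_rfl (i.le.trans_eq hR.symm)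
    refine h.trans ?_
    rw [inf_sSup_eq]
    refine iSup₂_le fun W hW => ?_
    obtain ⟨j, hj⟩ := hW
    refine le_sSup ⟨homOfLE inf_le_left, ?_⟩
    exact R.downward_closed hj (homOfLE inf_le_right)
  transitive' U R hR Q hQ := by
    refine le_antisymm (sSup_le fun _ h => h.choose.le) ?_
    refine (Eq.ge hR).trans (sSup_le fun V hV => ?_)
    obtain ⟨i, hi⟩ := hV
    refine (Eq.ge (hQ hi)).trans (sSup_le fun W hW => ?_)
    obtain ⟨j, hj⟩ := hW
    exact le_sSup ⟨j ≫ i, hj⟩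

/-- A family of multiplicative submonoids of the rings of sections of a presheaf of rings which is
stable under restriction. -/
structure SubmonoidPresheaf {C : Type v} [Category.{w} C] (F : Cᵒᵖ ⥤ CommRingCat.{u}) where
  obj : ∀ U : Cᵒᵖ, Submonoid (F.obj U)
  map : ∀ {U V : Cᵒᵖ} (i : U ⟶ V), obj U ≤ (obj V).comap (F.map i).hom

/-- The presheaf of rings `U ↦ F(U)[G(U)⁻¹]`. -/
noncomputable def SubmonoidPresheaf.localizationPresheaf {C : Type v} [Category.{w} C]
    {F : Cᵒᵖ ⥤ CommRingCat.{u}} (G : SubmonoidPresheaf F) : Cᵒᵖ ⥤ CommRingCat.{u} where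
  obj U := CommRingCat.of (Localization (G.obj U))
  map i := CommRingCat.ofHom (IsLocalization.map _ (F.map i).hom (G.map i))
  map_id U := by
    simp_rw [F.map_id]
    ext x
    exact IsLocalization.map_id x
  map_comp i j := by
    simp_rw [F.map_comp]
    ext : 1
    dsimp
    rw [IsLocalization.map_comp_map]

/-- The canonical morphism `F(U) → F(U)[G(U)⁻¹]` of presheaves of rings. -/
noncomputable def SubmonoidPresheaf.toLocalizationPresheaf {C : Type v} [Category.{w} C]
    {F : Cᵒᵖ ⥤ CommRingCat.{u}} (G : SubmonoidPresheaf F) : F ⟶ G.localizationPresheaf where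
  app U := CommRingCat.ofHom (algebraMap (F.obj U) (Localization (G.obj U)))
  naturality {U V} i := by
    ext x
    exact (IsLocalization.map_eq (S := Localization (G.obj U)) (Q := Localization (G.obj V))
      (G.map i) x).symm

section Constant

variable (X : Type v) [Order.Frame X] (M : Type v) [CommRing M]

/-- The constant presheaf of rings on a locale. -/
abbrev constPresheaf : Xᵒᵖ ⥤ CommRingCat.{v} := (Functor.const Xᵒᵖ).obj (CommRingCat.of M)

/-- The constant sheaf of rings associated to `M` on a locale: the sheafification of the constant
presheaf. -/
noncomputable abbrev constSheaf : Sheaf (localeTopology X) CommRingCat.{v} :=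
  (constantSheaf (localeTopology X) CommRingCat.{v}).obj (CommRingCat.of M)

/-- The constant sections, as a morphism from the constant presheaf to the constant sheaf. -/
noncomputable def toConstSheaf : constPresheaf X M ⟶ (constSheaf X M).obj :=
  toSheafify (localeTopology X) (constPresheaf X M)

variable {X M}

/-- The constant section with value `m` over the open `U`. -/
noncomputable def constSection (U : X) : M →+* (constSheaf X M).obj.obj (op U) :=
  ((toConstSheaf X M).app (op U)).hom

theorem map_constSection {U V : X} (i : V ⟶ U) (m : M) :
    (constSheaf X M).obj.map i.op (constSection U m) = constSection V m :=
  (NatTrans.naturality_apply (toConstSheaf X M) i.op m).symm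

/-- For a section `g` over `U` of the constant sheaf, regarded as a locale morphism from `U` to the
discrete locale `M`, the open `g⁻¹[{m}]`: the largest open `V ≤ U` on which `g` is constantly
`m`. -/
noncomputable def preimageSingleton {U : X} (g : (constSheaf X M).obj.obj (op U)) (m : M) : X :=
  sSup {V : X | ∃ i : V ⟶ U, (constSheaf X M).obj.map i.op g = constSection V m}

theorem le_preimageSingleton {U V : X} {g : (constSheaf X M).obj.obj (op U)} {m : M}
    (i : V ⟶ U) (h : (constSheaf X M).obj.map i.op g = constSection V m) :
    V ≤ preimageSingleton g m := le_sSup ⟨i, h⟩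

/-- Sections of the constant sheaf are locally constant. -/
theorem le_of_forall_const {U : X} (g : (constSheaf X M).obj.obj (op U)) {W : X}
    (h : ∀ (V : X) (i : V ⟶ U) (m : M),
      (constSheaf X M).obj.map i.op g = constSection V m → V ≤ W) : U ≤ W := by
  have hs := Presheaf.imageSieve_mem (localeTopology X)
    (toSheafify (localeTopology X) (constPresheaf X M)) g
  refine (Eq.ge hs).trans (sSup_le fun V hV => ?_)
  obtain ⟨i, m, hm⟩ := hV
  exact h V i m hm.symm

/-- Two constant sections can only agree locally where their values agree. -/
theorem le_of_constSection_eq {U : X} {m n : M}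
    (h : (constSection U m : (constSheaf X M).obj.obj (op U)) = constSection U n) {W : X}
    (hW : m = n → U ≤ W) : U ≤ W := by
  have hs := Presheaf.equalizerSieve_mem (localeTopology X)
    (toSheafify (localeTopology X) (constPresheaf X M)) (X := op U) m n h
  refine (Eq.ge hs).trans (sSup_le fun V hV => ?_)
  obtain ⟨i, hi⟩ := hV
  exact i.le.trans (hW hi)

end Constant

/-! ## The sheaf `A^∼` -/

section Tilde

variable (A : Type u) [CommRing A]

/-- The constant sheaf of rings associated to `A` on `Spec(A)`. (The frame of opens of `Spec(A)`
lives one universe above `A`, hence the `ULift`.) -/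
noncomputable abbrev constA : Sheaf (localeTopology (SpecOpens A)) CommRingCat.{u + 1} :=
  constSheaf (SpecOpens A) (ULift.{u + 1} A)

/-- The generic prime filter as a subsheaf of the constant sheaf on `Spec(A)`: its sections over
`U` are those sections `g` of the constant sheaf with `g⁻¹[{x}] ≤ [D(x)]` for all `x : A`. -/
noncomputable def genericPrimeFilter : SubmonoidPresheaf (constA A).obj where
  obj U :=
    { carrier := {g | ∀ x : ULift.{u + 1} A,
        preimageSingleton (U := U.unop) g x ≤ basicOpen x.down}
      one_mem' := by
        intro x
        refine sSup_le fun V hV => ?_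
        obtain ⟨i, hi⟩ := hV
        rw [map_one, ← map_one (constSection (X := SpecOpens A) V)] at hi
        refine le_of_constSection_eq hi fun h => ?_
        subst h
        exact le_top.trans_eq basicOpen_one.symm
      mul_mem' := by
        intro g h hg hh x
        refine sSup_le fun V hV => ?_
        obtain ⟨i, hi⟩ := hV
        refine le_of_forall_const ((constA A).obj.map i.op g) fun W j a ha => ?_
        refine le_of_forall_const ((constA A).obj.map (j ≫ i).op h) fun Z k b hb => ?_
        have ha' : (constA A).obj.map (k ≫ j ≫ i).op g = constSection Z a := by
          rw [op_comp, Functor.map_comp, op_comp, Functor.map_comp, ConcreteCategory.comp_apply,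
            ConcreteCategory.comp_apply, ha, map_constSection]
        have hb' : (constA A).obj.map (k ≫ j ≫ i).op h = constSection Z b := by
          rw [op_comp, Functor.map_comp, ConcreteCategory.comp_apply, hb]
        have hx : (constA A).obj.map (k ≫ j ≫ i).op (g * h) = constSection Z x := by
          rw [← Category.assoc, op_comp, Functor.map_comp, ConcreteCategory.comp_apply, hi,
            map_constSection]
        rw [map_mul, ha', hb', ← map_mul] at hx
        refine le_of_constSection_eq hx fun hab => ?_
        have h1 : Z ≤ basicOpen a.down :=
          le_trans (le_preimageSingleton (k ≫ j ≫ i) ha') (hg a)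
        have h2 : Z ≤ basicOpen b.down :=
          le_trans (le_preimageSingleton (k ≫ j ≫ i) hb') (hh b)
        rw [← hab]
        exact (le_inf h1 h2).trans (basicOpen_inf_le _ _) }
  map {U V} i g hg x := by
    refine le_trans (sSup_le fun W hW => ?_) (hg x)
    obtain ⟨j, hj⟩ := hW
    refine le_sSup ⟨j ≫ i.unop, ?_⟩
    rw [op_comp, Functor.map_comp, ConcreteCategory.comp_apply]
    exact hj

/-- Membership in the generic prime filter is local, so that it is a subsheaf of the constant
sheaf. -/
theorem mem_genericPrimeFilter_of_cover {U : SpecOpens A} (R : Sieve U)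
    (hR : R ∈ localeTopology (SpecOpens A) U) (g : (constA A).obj.obj (op U))
    (h : ∀ ⦃V : SpecOpens A⦄ (i : V ⟶ U), R i →
      (constA A).obj.map i.op g ∈ (genericPrimeFilter A).obj (op V)) :
    g ∈ (genericPrimeFilter A).obj (op U) := by
  refine fun x => sSup_le fun V hV => ?_
  obtain ⟨i, hi⟩ := hV
  have hV : V ≤ V ⊓ sSup {W : SpecOpens A | ∃ j : W ⟶ U, R j} :=
    le_inf le_rfl (i.le.trans_eq (Eq.symm hR))
  refine hV.trans ?_
  rw [inf_sSup_eq]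
  refine iSup₂_le fun W hW => ?_
  obtain ⟨j, hj⟩ := hW
  refine le_trans ?_ (h j hj x)
  have l : V ⊓ W ⟶ V := homOfLE inf_le_left
  have r : V ⊓ W ⟶ W := homOfLE inf_le_right
  refine le_preimageSingleton r ?_
  have e : r ≫ j = l ≫ i := Subsingleton.elim _ _
  have : (constA A).obj.map (r ≫ j).op g = constSection (V ⊓ W) x := by
    rw [e, op_comp, Functor.map_comp, ConcreteCategory.comp_apply, hi, map_constSection]
  rwa [op_comp, Functor.map_comp, ConcreteCategory.comp_apply] at this

/-- The sheaf of rings `A^∼` on `Spec(A)`: the localization of the constant sheaf at the generic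
prime filter, that is, the sheafification of `U ↦ A̲(U)[𝔣₀(U)⁻¹]`. -/
noncomputable def tilde : Sheaf (localeTopology (SpecOpens A)) CommRingCat.{u + 1} :=
  (presheafToSheaf (localeTopology (SpecOpens A)) CommRingCat.{u + 1}).obj
    (genericPrimeFilter A).localizationPresheaf

/-- The localization morphism from the constant sheaf on `Spec(A)` to `A^∼`. -/
noncomputable def constToTilde : constA A ⟶ tilde A where
  hom := (genericPrimeFilter A).toLocalizationPresheaf ≫
    toSheafify (localeTopology (SpecOpens A)) (genericPrimeFilter A).localizationPresheaf

/-- The ring `A^∼(U)` of sections of `A^∼` over an open `U` of `Spec(A)`. -/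
abbrev tildeSections (U : SpecOpens A) : Type (u + 1) := (tilde A).obj.obj (op U)

/-- The canonical ring homomorphism `A → A^∼(U)`: an element of `A` is mapped to the constant
section of the constant sheaf, and then to `A^∼` by the localization morphism. -/
noncomputable def toTilde (U : SpecOpens A) : A →+* tildeSections A U :=
  (((constToTilde A).hom.app (op U)).hom.comp (constSection U)).comp
    (ULift.ringEquiv.symm : A ≃+* ULift.{u + 1} A).toRingHom

end Tilde

end LocalicSpec

namespace LocalicSpec

variable {A : Type u} [CommRing A]

/-! ## The lattice of opens of the localic spectrum -/

/-! The opens D(g) form a basis of Spec(A), and inclusions among them are governed by ideals.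
Complements of prime ideals are models of the theory, so by soundness a covering of D(f) by opens V
puts f in every prime that contains all g with D(g) ≤ some V. Hence f lies in the radical of the
ideal they generate (`mem_radical_span_of_basicOpen_le`).

On the sheaf side, sheafification is locally surjective and locally injective, and sections of the
constant sheaf are locally constant. So a section of A^∼ is locally a fraction a/b with b
invertible, and an element of A that dies in A^∼ is locally killed by such a b.

To globalize, it suffices to show that some power of f lies in a suitable ideal, and membership in
its radical can be tested on a cover (`mem_radical_of_basicOpen_le`). The annihilator of a yields
the kernel of A → A^∼(D(f)); the ideal of denominators of a section s shows that f^n s comes from A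
for some n. The latter needs that a section vanishing on D(g) is killed by a power of g, which rests
on compactness. No sections are ever glued: only separatedness and the local description enter. -/

theorem basicOpen_zero : basicOpen (0 : A) = ⊥ :=
  le_bot_iff.1 ((genericPrimeFilterModel A).valid _ _ PrimeFilterAxiom.zero)

theorem basicOpen_add_le (f g : A) : basicOpen (f + g) ≤ basicOpen f ⊔ basicOpen g :=
  (genericPrimeFilterModel A).valid _ _ (PrimeFilterAxiom.add f g)

theorem basicOpen_mul_le_left (f g : A) : basicOpen (f * g) ≤ basicOpen f :=
  (genericPrimeFilterModel A).valid _ _ (PrimeFilterAxiom.mul_left f g)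

theorem basicOpen_mul (f g : A) : basicOpen (f * g) = basicOpen f ⊓ basicOpen g :=
  le_antisymm
    (le_inf (basicOpen_mul_le_left f g) (mul_comm f g ▸ basicOpen_mul_le_left g f))
    (basicOpen_inf_le f g)

theorem basicOpen_le_basicOpen_pow (f : A) (n : ℕ) : basicOpen f ≤ basicOpen (f ^ n) := by
  induction n with
  | zero => rw [pow_zero, basicOpen_one]; exact le_top
  | succ n ih => rw [pow_succ, basicOpen_mul]; exact le_inf ih le_rfl

/-- Finite meets of symbols collapse to a single symbol, so with `normal_form` the opens D(g) form a
basis. -/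
theorem cls_conj (l : List A) : cls (primeFilterTheory A) (conj l) = basicOpen l.prod := by
  induction l with
  | nil => exact basicOpen_one.symm
  | cons a l ih => rw [List.prod_cons, basicOpen_mul, ← ih]; rfl

/-! ### Prime ideals as models, and covers of basic opens -/

/-- The prime filter complementary to a prime ideal is a model of the theory of prime filters. -/
theorem eval_of_provable (p : Ideal A) [p.IsPrime] {φ ψ : GeoFormula A}
    (h : Provable (primeFilterTheory A) φ ψ) :
    φ.eval (fun x => x ∉ p) → ψ.eval (fun x => x ∉ p) := by
  induction h with
  | ax h =>
    cases h with
    | zero => exact fun h => (h p.zero_mem).elim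
    | add x y => exact fun h => not_and_or.1 fun hxy => h (p.add_mem hxy.1 hxy.2)
    | mul_left x y => exact fun h hx => h (p.mul_mem_right _ hx)
    | one => exact fun _ => p.one_notMem
    | mul x y => exact fun h hxy => ((‹p.IsPrime›).mem_or_mem hxy).elim h.1 h.2
  | refl φ => exact id
  | cut _ _ h k => exact k ∘ h
  | top_intro φ => exact fun _ => trivial
  | and_left φ ψ => exact And.left
  | and_right φ ψ => exact And.right
  | and_intro _ _ h k => exact fun x => ⟨h x, k x⟩
  | bot_elim φ => exact False.elim
  | or_left φ ψ => exact Or.inl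
  | or_right φ ψ => exact Or.inr
  | or_elim _ _ h k => exact fun x => x.elim h k
  | disj_intro φ i => exact fun x => iSup_Prop_eq.mpr ⟨i, x⟩
  | disj_elim _ h =>
    intro x
    obtain ⟨i, hi⟩ := iSup_Prop_eq.mp x
    exact h i hi
  | distrib φ ψ =>
    intro x
    obtain ⟨i, hi⟩ := iSup_Prop_eq.mp x.1
    exact iSup_Prop_eq.mpr ⟨i, hi, x.2⟩

theorem eval_conj {p : Ideal A} [p.IsPrime] {l : List A}
    (h : (conj l).eval (fun x => x ∉ p)) : l.prod ∉ p := by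
  induction l with
  | nil => exact p.one_notMem
  | cons a l ih =>
    rw [List.prod_cons]
    exact fun hal => ((‹p.IsPrime›).mem_or_mem hal).elim h.1 (ih h.2)

/-- The radical is the intersection of the primes above the span. At such a prime not containing f,
soundness makes some disjunct of the join true, and the product of its symbols is a generator
outside the prime: a contradiction. -/
theorem mem_radical_span_of_basicOpen_le {f : A} {s : Set (SpecOpens A)}
    (h : basicOpen f ≤ sSup s) :
    f ∈ (Ideal.span {g : A | ∃ V ∈ s, basicOpen g ≤ V}).radical := by
  rw [Ideal.radical_eq_sInf, Submodule.mem_sInf]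
  rintro p ⟨hp, hprime⟩
  by_contra hf
  have hs : Provable (primeFilterTheory A) (.sym f) (joinFormula s) := h
  obtain ⟨⟨l, x, hx, hl⟩, hi⟩ := iSup_Prop_eq.mp (eval_of_provable p hs hf)
  rw [cls_conj] at hl
  exact eval_conj hi (hp (Ideal.subset_span ⟨x, hx, hl⟩))

/-- The elements f with D(f) ≤ W form an ideal, by the axioms for 0, sums and products. -/
theorem basicOpen_le_of_mem_span {W : SpecOpens A} {s : Set A} (hs : ∀ g ∈ s, basicOpen g ≤ W)
    {f : A} (hf : f ∈ Ideal.span s) : basicOpen f ≤ W := by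
  induction hf using Submodule.span_induction with
  | mem g hg => exact hs g hg
  | zero => exact basicOpen_zero.trans_le bot_le
  | add x y _ _ hx hy => exact (basicOpen_add_le x y).trans (sup_le hx hy)
  | smul a x _ hx =>
    rw [smul_eq_mul, mul_comm]
    exact (basicOpen_mul_le_left x a).trans hx

/-- A prime containing g but not f would violate soundness, so f is in the radical of (g). This
serves to rewrite a fraction with denominator g as one whose denominator is a power of f. -/
theorem exists_pow_eq_mul_of_basicOpen_le {f g : A} (h : basicOpen f ≤ basicOpen g) :
    ∃ (n : ℕ) (c : A), f ^ n = c * g := by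
  have hf : f ∈ (Ideal.span {g}).radical := by
    rw [Ideal.radical_eq_sInf, Submodule.mem_sInf]
    rintro p ⟨hp, hprime⟩
    by_contra hf
    exact eval_of_provable p (cls_le_cls.1 h) hf (hp (Ideal.mem_span_singleton_self g))
  obtain ⟨n, hn⟩ := hf
  obtain ⟨c, hc⟩ := Ideal.mem_span_singleton'.1 hn
  exact ⟨n, c, hc.symm⟩

/-- Basic opens are compact. -/
theorem exists_finset_basicOpen_le {f : A} {s : Set (SpecOpens A)} (h : basicOpen f ≤ sSup s) :
    ∃ t : Finset A, (∀ g ∈ t, ∃ V ∈ s, basicOpen g ≤ V) ∧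
      ∃ n : ℕ, f ^ n ∈ Ideal.span (t : Set A) := by
  obtain ⟨n, hn⟩ := mem_radical_span_of_basicOpen_le h
  -- Compactness is the finiteness of the linear combination expressing f^n.
  obtain ⟨t, ht, hnt⟩ := Submodule.mem_span_finite_of_mem_span hn
  exact ⟨t, fun g hg => ht hg, n, hnt⟩

/-! ## Sections of `A^∼` -/

/-- Restriction of sections of `A^∼`. -/
noncomputable def tildeRes {U V : SpecOpens A} (h : V ≤ U) :
    tildeSections A U →+* tildeSections A V :=
  ((tilde A).obj.map (homOfLE h).op).hom

theorem tildeRes_tildeRes {U V W : SpecOpens A} (h : V ≤ U) (k : W ≤ V) (s : tildeSections A U) :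
    tildeRes k (tildeRes h s) = tildeRes (k.trans h) s := by
  have := congrArg (fun f => f s) (congrArg CommRingCat.Hom.hom
    ((tilde A).obj.map_comp (homOfLE h).op (homOfLE k).op))
  exact this.symm

theorem tildeRes_constToTilde {U V : SpecOpens A} (h : V ≤ U) (g : (constA A).obj.obj (op U)) :
    tildeRes h ((constToTilde A).hom.app (op U) g) =
      (constToTilde A).hom.app (op V) ((constA A).obj.map (homOfLE h).op g) :=
  (NatTrans.naturality_apply (constToTilde A).hom (homOfLE h).op g).symm

theorem toTilde_apply (U : SpecOpens A) (a : A) :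
    toTilde A U a = (constToTilde A).hom.app (op U) (constSection U (ULift.up a)) := rfl

theorem tildeRes_toTilde {U V : SpecOpens A} (h : V ≤ U) (a : A) :
    tildeRes h (toTilde A U a) = toTilde A V a := by
  rw [toTilde_apply, tildeRes_constToTilde, map_constSection, toTilde_apply]

/-- The canonical map from fractions of sections of the constant sheaf to sections of `A^∼`. -/
noncomputable def fractionToTilde (U : SpecOpens A) :
    Localization ((genericPrimeFilter A).obj (op U)) →+* tildeSections A U :=
  ((toSheafify (localeTopology (SpecOpens A))
    (genericPrimeFilter A).localizationPresheaf).app (op U)).hom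

theorem constToTilde_apply (U : SpecOpens A) (g : (constA A).obj.obj (op U)) :
    (constToTilde A).hom.app (op U) g = fractionToTilde U (algebraMap _ _ g) := rfl

/-- The constant section a can take a value x ≠ a only on the empty open. -/
theorem constSection_mem_genericPrimeFilter {U : SpecOpens A} {a : A} (h : U ≤ basicOpen a) :
    constSection U (ULift.up a) ∈ (genericPrimeFilter A).obj (op U) := by
  refine fun x => sSup_le fun V hV => ?_
  obtain ⟨i, hi⟩ := hV
  rw [map_constSection] at hi
  refine le_of_constSection_eq hi fun hx => ?_
  subst hx
  exact i.le.trans h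

/-- On opens below `D(a)`, the element `a` becomes invertible in `A^∼`. -/
theorem isUnit_toTilde {U : SpecOpens A} {a : A} (h : U ≤ basicOpen a) :
    IsUnit (toTilde A U a) := by
  rw [toTilde_apply, constToTilde_apply]
  exact (IsLocalization.map_units (Localization ((genericPrimeFilter A).obj (op U)))
    ⟨_, constSection_mem_genericPrimeFilter h⟩).map
      (fractionToTilde U)

/-! ### Local description of sections -/

/-- Sections of `A^∼` which vanish on a cover vanish. -/
theorem eq_zero_of_cover {U : SpecOpens A} (s : tildeSections A U)
    (h : ∀ W : SpecOpens A, (∀ (V : SpecOpens A) (hV : V ≤ U), tildeRes hV s = 0 → V ≤ W) →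
      U ≤ W) : s = 0 := by
  let R : Sieve U :=
    { arrows := fun V i => tildeRes i.le s = 0
      downward_closed := by
        intro V W i hi j
        rw [← tildeRes_tildeRes i.le j.le, hi, map_zero] }
  refine Sheaf.isSeparated (tilde A) U R ?_ s 0 fun V i hi => ?_
  -- Covers are expressed by quantifying over upper bounds `W`; taking `W` to be the join of the
  -- sieve recovers the covering condition.
  · refine le_antisymm (sSup_le fun _ h => h.choose.le) (h _ fun V hV hs => ?_)
    exact le_sSup ⟨homOfLE hV, hs⟩
  · rw [map_zero]
    exact hi

/-- Sections of `A^∼` are locally fractions of elements of `A`. -/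
theorem le_of_forall_fraction {U W : SpecOpens A} (s : tildeSections A U)
    (h : ∀ (V : SpecOpens A) (hV : V ≤ U) (a b : A), V ≤ basicOpen b →
      toTilde A V b * tildeRes hV s = toTilde A V a → V ≤ W) : U ≤ W := by
  have hs := Presheaf.imageSieve_mem (localeTopology (SpecOpens A))
    (toSheafify (localeTopology (SpecOpens A)) (genericPrimeFilter A).localizationPresheaf)
    (U := op U) s
  refine (Eq.ge hs).trans (sSup_le fun V hV => ?_)
  obtain ⟨i, hi⟩ := hV
  obtain ⟨t, ht⟩ : ∃ t : Localization ((genericPrimeFilter A).obj (op V)),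
    fractionToTilde V t = tildeRes i.le s := hi
  obtain ⟨⟨x, y⟩, hxy⟩ := IsLocalization.surj ((genericPrimeFilter A).obj (op V)) t
  have key : (constToTilde A).hom.app (op V) y.1 * tildeRes i.le s =
      (constToTilde A).hom.app (op V) x := by
    rw [constToTilde_apply, constToTilde_apply, ← hxy, map_mul, mul_comm, ht]
  -- Shrink the open until both the numerator and the denominator are constant.
  refine le_of_forall_const x fun V₁ j a ha => ?_
  refine le_of_forall_const ((constA A).obj.map j.op y.1) fun V₂ k b hb => ?_
  have ha' : (constA A).obj.map (k ≫ j).op x = constSection V₂ a := by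
    rw [op_comp, Functor.map_comp, ConcreteCategory.comp_apply, ha, map_constSection]
  have hb' : (constA A).obj.map (k ≫ j).op y.1 = constSection V₂ b := by
    rw [op_comp, Functor.map_comp, ConcreteCategory.comp_apply, hb]
  refine h V₂ ((k ≫ j).le.trans i.le) a.down b.down
    ((le_preimageSingleton (k ≫ j) hb').trans (y.2 b)) ?_
  have := congrArg (tildeRes (k ≫ j).le) key
  rw [map_mul, tildeRes_constToTilde, tildeRes_constToTilde, tildeRes_tildeRes] at this
  exact (congrArg (fun z => (constToTilde A).hom.app (op V₂) z * _) hb').symm.trans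
    (this.trans (congrArg ((constToTilde A).hom.app (op V₂)) ha'))

/-- An element of `A` which vanishes in `A^∼` is locally annihilated by invertible elements. -/
theorem le_of_toTilde_eq_zero {U W : SpecOpens A} {a : A} (ha : toTilde A U a = 0)
    (h : ∀ (V : SpecOpens A) (b : A), V ≤ basicOpen b → b * a = 0 → V ≤ W) : U ≤ W := by
  rw [toTilde_apply, constToTilde_apply] at ha
  have hs := Presheaf.equalizerSieve_mem (localeTopology (SpecOpens A))
    (toSheafify (localeTopology (SpecOpens A)) (genericPrimeFilter A).localizationPresheaf)
    (X := op U) _ 0 (ha.trans (map_zero _).symm)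
  refine (Eq.ge hs).trans (sSup_le fun V hV => ?_)
  obtain ⟨i, hi⟩ := hV
  have hi' : algebraMap _ (Localization ((genericPrimeFilter A).obj (op V)))
      (constSection V (ULift.up a)) = 0 := by
    rw [← map_constSection i]
    exact (NatTrans.naturality_apply (genericPrimeFilter A).toLocalizationPresheaf i.op _).trans
      (hi.trans (map_zero _))
  obtain ⟨y, hy⟩ := (IsLocalization.map_eq_zero_iff ((genericPrimeFilter A).obj (op V)) _ _).1 hi'
  refine le_of_forall_const y.1 fun V₁ j b hb => ?_
  have h0 : constSection V₁ (b * ULift.up a) = constSection V₁ 0 := by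
    rw [map_mul, map_zero, ← hb, ← map_constSection j, ← map_mul, hy, map_zero]
  -- If b a ≠ 0 in A, then `V₁` is empty and lies below `W` trivially.
  refine le_of_constSection_eq h0 fun hba => ?_
  exact h V₁ b.down ((le_preimageSingleton j hb).trans (y.2 b)) (congrArg ULift.down hba)

/-! ## Sections of `A^∼` over basic opens -/

/-- Local-to-global principle: a property of f cut out by the radical of an ideal can be checked on
basic opens refining a cover of D(f). -/
theorem mem_radical_of_basicOpen_le {f : A} {s : Set (SpecOpens A)} {I : Ideal A}
    (h : basicOpen f ≤ sSup s) (hI : ∀ V ∈ s, ∀ g : A, basicOpen g ≤ V → g ∈ I.radical) :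
    f ∈ I.radical := by
  refine Ideal.radical_le_radical_iff.2 (Ideal.span_le.2 ?_) (mem_radical_span_of_basicOpen_le h)
  rintro g ⟨V, hV, hg⟩
  exact hI V hV g hg

theorem exists_pow_mul_eq_zero_of_toTilde_eq_zero {f a : A}
    (h : toTilde A (basicOpen f) a = 0) : ∃ n : ℕ, f ^ n * a = 0 := by
  -- If D(g) ≤ V ≤ D(b) and b a = 0, a power of g is a multiple of b and so kills a.
  have hf : f ∈ (Ideal.torsionOf A A a).radical := by
    refine mem_radical_of_basicOpen_le (s := {V | ∃ b : A, V ≤ basicOpen b ∧ b * a = 0})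
      (le_of_toTilde_eq_zero h fun V b hb hba => le_sSup ⟨b, hb, hba⟩) ?_
    rintro V ⟨b, hb, hba⟩ g hg
    obtain ⟨n, c, hn⟩ := exists_pow_eq_mul_of_basicOpen_le (hg.trans hb)
    refine ⟨n, ?_⟩
    rw [Ideal.mem_torsionOf_iff, smul_eq_mul, hn, mul_assoc, hba, mul_zero]
  obtain ⟨n, hn⟩ := hf
  exact ⟨n, hn⟩

/-- A section over `D(f)` which vanishes on `D(g)` is annihilated by a power of `g`. -/
theorem exists_toTilde_pow_mul_eq_zero {f g : A} (t : tildeSections A (basicOpen f))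
    (h : tildeRes (inf_le_left : basicOpen f ⊓ basicOpen g ≤ basicOpen f) t = 0) :
    ∃ n : ℕ, toTilde A (basicOpen f) (g ^ n) * t = 0 := by
  obtain ⟨T, hT, k, hk⟩ := exists_finset_basicOpen_le (f := f)
    (s := {V | ∃ (hV : V ≤ basicOpen f) (a b : A), V ≤ basicOpen b ∧
      toTilde A V b * tildeRes hV t = toTilde A V a})
    (le_of_forall_fraction t fun V hV a b hb hab => le_sSup ⟨hV, a, b, hb, hab⟩)
  have key : ∀ x ∈ T, ∃ n : ℕ, ∃ hx : basicOpen x ≤ basicOpen f,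
      toTilde A (basicOpen x) (g ^ n) * tildeRes hx t = 0 := by
    intro x hx
    obtain ⟨V, ⟨hV, a, b, hb, hab⟩, hxV⟩ := hT x hx
    have hab' := congrArg (tildeRes hxV) hab
    rw [map_mul, tildeRes_toTilde, tildeRes_toTilde, tildeRes_tildeRes] at hab'
    have hle : basicOpen (x * g) ≤ basicOpen f ⊓ basicOpen g := by
      rw [basicOpen_mul]
      exact inf_le_inf_right _ (hxV.trans hV)
    have ht : tildeRes (hle.trans inf_le_left) t = 0 := by
      rw [← tildeRes_tildeRes inf_le_left hle, h, map_zero]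
    -- On D(x) the section is a/b. As it vanishes on D(xg), so does a, whence (xg)^n a = 0 in A for
    -- some n; cancelling the units b and x^n on D(x) leaves g^n t = 0 there.
    have ha := congrArg (tildeRes (basicOpen_mul_le_left x g)) hab'
    rw [map_mul, tildeRes_toTilde, tildeRes_toTilde, tildeRes_tildeRes, ht, mul_zero] at ha
    obtain ⟨n, hn⟩ := exists_pow_mul_eq_zero_of_toTilde_eq_zero ha.symm
    refine ⟨n, hxV.trans hV, ?_⟩
    refine (isUnit_toTilde (hxV.trans hb)).mul_right_eq_zero.1 ?_
    refine (isUnit_toTilde (basicOpen_le_basicOpen_pow x n)).mul_right_eq_zero.1 ?_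
    rw [mul_left_comm (toTilde A (basicOpen x) b), hab', ← map_mul, ← map_mul, ← mul_assoc,
      ← mul_pow, hn, map_zero]
  choose! n hle hn using key
  -- Finiteness of `T` allows one exponent to serve on all D(x).
  refine ⟨T.sup n, eq_zero_of_cover _ fun W hW => ?_⟩
  refine (basicOpen_le_basicOpen_pow f k).trans (basicOpen_le_of_mem_span (fun x hx => ?_) hk)
  refine hW _ (hle x hx) ?_
  rw [map_mul, tildeRes_toTilde, ← Nat.sub_add_cancel (Finset.le_sup hx : n x ≤ T.sup n), pow_add,
    map_mul, mul_assoc, hn x hx, mul_zero]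

/-- The ideal of denominators of a section of `A^∼`. -/
noncomputable def denominators {U : SpecOpens A} (s : tildeSections A U) : Ideal A where
  carrier := {x | ∃ a, toTilde A U x * s = toTilde A U a}
  zero_mem' := ⟨0, by rw [map_zero, zero_mul]⟩
  add_mem' := by
    rintro x y ⟨a, ha⟩ ⟨b, hb⟩
    exact ⟨a + b, by rw [map_add, map_add, add_mul, ha, hb]⟩
  smul_mem' := by
    rintro c x ⟨a, ha⟩
    exact ⟨c * a, by rw [smul_eq_mul, map_mul, map_mul, mul_assoc, ha]⟩

/-- The claim says that f is in the radical of the ideal of denominators of s, so it can be tested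
on the opens where s is a fraction. -/
theorem exists_toTilde_pow_mul_eq {f : A} (s : tildeSections A (basicOpen f)) :
    ∃ (n : ℕ) (a : A), toTilde A (basicOpen f) (f ^ n) * s = toTilde A (basicOpen f) a := by
  change f ∈ (denominators s).radical
  refine mem_radical_of_basicOpen_le
    (s := {V | ∃ (hV : V ≤ basicOpen f) (a b : A), V ≤ basicOpen b ∧
      toTilde A V b * tildeRes hV s = toTilde A V a})
    (le_of_forall_fraction s fun V hV a b hb hab => le_sSup ⟨hV, a, b, hb, hab⟩) ?_
  rintro V ⟨hV, a, b, hb, hab⟩ g hg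
  obtain ⟨n, c, hn⟩ := exists_pow_eq_mul_of_basicOpen_le (hg.trans hb)
  have hle : basicOpen f ⊓ basicOpen g ≤ V := inf_le_right.trans hg
  -- With b s = a on V and g^n = c b, the section g^n s - c a vanishes on D(g); a power g^m kills it
  -- on all of D(f), so g^(m+n) is a denominator.
  obtain ⟨m, hm⟩ := exists_toTilde_pow_mul_eq_zero (g := g)
    (toTilde A (basicOpen f) (g ^ n) * s - toTilde A (basicOpen f) (c * a)) <| by
      have := congrArg (tildeRes hle) hab
      rw [map_mul, tildeRes_toTilde, tildeRes_toTilde, tildeRes_tildeRes] at this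
      rw [map_sub, map_mul, tildeRes_toTilde, tildeRes_toTilde, hn, map_mul, map_mul, mul_assoc,
        this, sub_self]
  refine ⟨m + n, g ^ m * (c * a), ?_⟩
  rw [pow_add, map_mul, map_mul _ _ (c * a), mul_assoc]
  rw [mul_sub] at hm
  exact sub_eq_zero.1 hm

/-! ### Identification with the localization -/

/-- The ring of sections of `A^∼` over `D(f)` is the localization of `A` away from `f`. -/
theorem isLocalization_away_toTilde (f : A) :
    letI := (toTilde A (basicOpen f)).toAlgebra
    IsLocalization.Away f (tildeSections A (basicOpen f)) := by
  let := (toTilde A (basicOpen f)).toAlgebra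
  refine ⟨?_, ?_, ?_⟩
  · rintro ⟨_, n, rfl⟩
    exact isUnit_toTilde (basicOpen_le_basicOpen_pow f n)
  · intro s
    obtain ⟨n, a, h⟩ := exists_toTilde_pow_mul_eq s
    exact ⟨⟨a, ⟨f ^ n, n, rfl⟩⟩, (mul_comm _ _).trans h⟩
  · intro a b hab
    obtain ⟨n, hn⟩ := exists_pow_mul_eq_zero_of_toTilde_eq_zero (f := f) (a := a - b)
      (by rw [map_sub]; exact sub_eq_zero.2 hab)
    exact ⟨⟨f ^ n, n, rfl⟩, sub_eq_zero.1 ((mul_sub _ _ _).symm.trans hn)⟩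

/-- Localizing at the unit 1 changes nothing. The statement stays over D(1), and the bijectivity is
transported to ⊤ afterwards, with no algebra structure left to carry along. -/
theorem bijective_toTilde_basicOpen_one : Function.Bijective (toTilde A (basicOpen 1)) := by
  let := (toTilde A (basicOpen 1)).toAlgebra
  have := isLocalization_away_toTilde (1 : A)
  exact (IsLocalization.atUnit A (tildeSections A (basicOpen 1)) 1 isUnit_one).bijective

end LocalicSpec

/-- For every `f`, there is a canonical isomorphism `A[f⁻¹] ≅ A^∼([D(f)])` of rings, that is, a
unique ring isomorphism under `A`, and the canonical map `A → A^∼(Spec(A))` is an isomorphism. -/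
theorem mainTheorem5 {A : Type u} [CommRing A] :
    (∀ f : A, ∃! e : Localization.Away f ≃+* LocalicSpec.tildeSections A (LocalicSpec.basicOpen f),
      ∀ a : A, e (algebraMap A (Localization.Away f) a) =
        LocalicSpec.toTilde A (LocalicSpec.basicOpen f) a) ∧
    (∃! e : A ≃+* LocalicSpec.tildeSections A ⊤,
      ∀ a : A, e a = LocalicSpec.toTilde A ⊤ a) := by
  refine ⟨fun f => ?_, ?_⟩
  · let := (LocalicSpec.toTilde A (LocalicSpec.basicOpen f)).toAlgebra
    have := LocalicSpec.isLocalization_away_toTilde f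
    refine ⟨(IsLocalization.algEquiv (Submonoid.powers f) (Localization.Away f)
      (LocalicSpec.tildeSections A (LocalicSpec.basicOpen f))).toRingEquiv,
      fun a => AlgEquiv.commutes _ a, fun e he => ?_⟩
    -- Uniqueness: ring homomorphisms out of a localization are determined by their restriction to
    -- A.
    refine RingEquiv.toRingHom_injective
      (IsLocalization.ringHom_ext (Submonoid.powers f) (RingHom.ext fun a => ?_))
    exact (he a).trans (AlgEquiv.commutes (IsLocalization.algEquiv (Submonoid.powers f)
      (Localization.Away f) (LocalicSpec.tildeSections A (LocalicSpec.basicOpen f))) a).symm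
  · have h := LocalicSpec.bijective_toTilde_basicOpen_one (A := A)
    rw [LocalicSpec.basicOpen_one] at h
    exact ⟨RingEquiv.ofBijective _ h, fun a => rfl, fun e he => RingEquiv.ext he⟩
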